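/- Let $n$ be a natural number and let $K$ be a field with $\operatorname{char} K=0$ or $\operatorname{char} K>n$. Let $V_1,\dots,V_t$ be a complete set of representatives of the isomorphism classes of simple modules over the group algebra $KS_n$, and write $mV_i$ for the direct sum of $m$ copies of $V_i$. A $KS_n$-module is called $r$-generated (for an integer $r\ge 0$) if it is generated as a $KS_n$-module by $r$ (not necessarily distinct) elements. (1) Let $V$ be a finitely generated $KS_n$-module with canonical decomposition $V\cong\bigoplus_{i=1}^t n_iV_i$. Then $V$ is $r$-generated if and only if $n_i\le r\cdot\dim_K V_i$ for every $i$. In particular, the smallest $r$ such that $V$ is $r$-generated is $$r=\left\lceil\max\left\{\frac{n_i}{\dim_K V_i}\;\middle|\;1\le i\le t\right\}\right\rceil .$$ (2) Let $S_n$ act on $R=K[x_1,\dots,x_n]$ by $\sigma\cdot f(x_1,\dots,x_n)=f(x_{\sigma(1)},\dots,x_{\sigma(n)})$. For $f_1,\dots,f_r\in R$ let $(f_1,\dots,f_r)_{S_n}$ be the ideal generated by all $\sigma\cdot f_j$ with $\sigma\in S_n$ and $1\le j\le r$. An ideal of $R$ closed under the action is called symmetric. A symmetric ideal $I$ is called $r$-generated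 if $I=(f_1,\dots,f_r)_{S_n}$ for some homogeneous $f_1,\dots,f_r$ of the same degree, and principal symmetric if it is $1$-generated. Let $I$ be a symmetric ideal that is generated by homogeneous polynomials of a single degree $d$, let $I_d$ be its degree $d$ part, and let $I_d\cong\bigoplus_{i=1}^t n_iV_i$ be the canonical decomposition of the $KS_n$-module $I_d$. Then $I$ is $r$-generated if and only if $n_i\le r\cdot\dim_K V_i$ for every $i$; the smallest $r$ such that $I$ is $r$-generated is $\left\lceil\max_i n_i/\dim_K V_i\right\rceil$; and $I$ is a principal symmetric ideal if and only if $n_i\le\dim_K V_i$ for every $i$. -/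

import Mathlib

universe u v w

open scoped MonoidAlgebra

/-- An `A`-module `M` is `r`-generated if it is the span of `r` (not necessarily distinct)
elements. -/
def IsRGeneratedModule (A : Type*) [Ring A] (r : ℕ) (M : Type*) [AddCommGroup M] [Module A M] :
    Prop :=
  ∃ f : Fin r → M, Submodule.span A (Set.range f) = ⊤

/-- `S 0, …, S (t-1)` is a complete set of representatives of the isomorphism classes of simple
`A`-modules. Every simple `A`-module is a quotient of `A`, so it is enough (and equivalent) to
test completeness on simple modules in the universe of `A`. -/
structure IsCompleteSetOfSimples (A : Type u) [Ring A] {t : ℕ} (S : Fin t → Type v)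
    [∀ i, AddCommGroup (S i)] [∀ i, Module A (S i)] : Prop where
  simple : ∀ i, IsSimpleModule A (S i)
  pairwise_not_iso : ∀ i j, Nonempty (S i ≃ₗ[A] S j) → i = j
  complete : ∀ (M : Type u) [AddCommGroup M] [Module A M], IsSimpleModule A M →
    ∃ i, Nonempty (M ≃ₗ[A] S i)

/-- `M ≅ ⨁ᵢ mᵢ Sᵢ`, where `mᵢ Sᵢ` is the direct sum of `mᵢ` copies of `Sᵢ` (all the direct sums
are finite, so they are written as products). -/
def HasDecomposition (A : Type*) [Ring A] {t : ℕ} (S : Fin t → Type*)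
    [∀ i, AddCommGroup (S i)] [∀ i, Module A (S i)] (m : Fin t → ℕ)
    (M : Type*) [AddCommGroup M] [Module A M] : Prop :=
  Nonempty (M ≃ₗ[A] ((i : Fin t) → Fin (m i) → S i))

/-- The action of the symmetric group on `K[x₁, …, xₙ]`:
`σ • f (x₁, …, xₙ) = f (x_{σ 1}, …, x_{σ n})`. -/
noncomputable def permRep (K : Type*) [Field K] (n : ℕ) :
    Representation K (Equiv.Perm (Fin n)) (MvPolynomial (Fin n) K) where
  toFun σ := (MvPolynomial.rename σ).toLinearMap
  map_one' := by
    refine LinearMap.ext fun f => ?_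
    exact MvPolynomial.rename_id_apply f
  map_mul' σ τ := by
    refine LinearMap.ext fun f => ?_
    exact (MvPolynomial.rename_rename τ σ f).symm

/-- An ideal is symmetric if it is closed under the action of the symmetric group. -/
def IsSymmetricIdeal {K : Type*} [Field K] {n : ℕ} (I : Ideal (MvPolynomial (Fin n) K)) : Prop :=
  ∀ σ : Equiv.Perm (Fin n), ∀ f ∈ I, permRep K n σ f ∈ I

/-- The symmetric ideal `(f₁, …, f_r)_{Sₙ} = (σ • f_j : σ ∈ Sₙ, 1 ≤ j ≤ r)`. -/
noncomputable def symmetricIdealSpan {K : Type*} [Field K] {n r : ℕ}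
    (f : Fin r → MvPolynomial (Fin n) K) : Ideal (MvPolynomial (Fin n) K) :=
  Ideal.span {g | ∃ (σ : Equiv.Perm (Fin n)) (j : Fin r), g = permRep K n σ (f j)}

/-- `I = (f₁, …, f_r)_{Sₙ}` for some homogeneous `f₁, …, f_r` of the same degree. -/
def IsRGeneratedSymmetricIdeal {K : Type*} [Field K] {n : ℕ} (r : ℕ)
    (I : Ideal (MvPolynomial (Fin n) K)) : Prop :=
  ∃ (e : ℕ) (f : Fin r → MvPolynomial (Fin n) K),
    (∀ j, (f j).IsHomogeneous e) ∧ I = symmetricIdealSpan f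

/-- A principal symmetric ideal: a symmetric ideal `(f)_{Sₙ}` with `f` homogeneous. -/
def IsPrincipalSymmetricIdeal {K : Type*} [Field K] {n : ℕ}
    (I : Ideal (MvPolynomial (Fin n) K)) : Prop :=
  IsRGeneratedSymmetricIdeal 1 I

/-- `I` is generated by homogeneous polynomials of the single degree `d`. -/
def IsGeneratedInDegree {K : Type*} [Field K] {n : ℕ} (d : ℕ)
    (I : Ideal (MvPolynomial (Fin n) K)) : Prop :=
  I = Ideal.span {f | f ∈ I ∧ f.IsHomogeneous d}

/-- The degree `d` part `I_d` of a symmetric ideal `I`, as a subrepresentation of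
`K[x₁, …, xₙ]`. -/
noncomputable def idealDegreePart {K : Type*} [Field K] {n : ℕ}
    (I : Ideal (MvPolynomial (Fin n) K)) (hI : IsSymmetricIdeal I) (d : ℕ) :
    Subrepresentation (permRep K n) where
  toSubmodule := I.restrictScalars K ⊓ MvPolynomial.homogeneousSubmodule (Fin n) K d
  apply_mem_toSubmodule σ f hf :=
    ⟨hI σ f hf.1, MvPolynomial.IsHomogeneous.rename_isHomogeneous hf.2⟩

/-! ### Permutations and words -/

/-! Given `r` generators of `⨁ mᵢ Sᵢ`, each copy of `Sᵢ` yields a row of `r` components, a vector in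
`Sᵢ^r`. A `K`-linear relation among the rows is a homomorphism to `Sᵢ` killing all generators, hence
trivial; so `mᵢ ≤ r dim Sᵢ`. Conversely, rows chosen as distinct standard basis vectors of `Sᵢ^r`
give generators: a maximal submodule containing them would be the kernel of a nonzero map to some
`Sᵢ`, which is a combination of components if `End Sᵢ = K`, and independence of the rows makes it
zero.

Since `K` need not be algebraically closed, `End Sᵢ = K` needs proof
(`exists_smul_eq_of_isSimpleModule_perm`). If the invariants of some subgroup form a line `Kv`, an
endomorphism scales `v`, and `v` generates. Such a subgroup is the stabilizer of a word with least
letter sum among those whose stabilizers have nonzero invariants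
(`subgroupSum_mem_span_of_minimal`).

For ideals, the degree `d` part of an ideal generated by forms of degree `d` is their `K`-span, so
generating `I` and generating `I_d` amount to the same (`isRGeneratedSymmetricIdeal_iff`). -/

theorem Equiv.Perm.exists_comp_eq_of_card_fiber_eq {α β : Type*} [Fintype α] [DecidableEq β]
    (f g : α → β)
    (h : ∀ b, (Finset.univ.filter fun a => f a = b).card =
      (Finset.univ.filter fun a => g a = b).card) :
    ∃ σ : Equiv.Perm α, g ∘ σ = f := by
  have e : ∀ b, Nonempty ({a // f a = b} ≃ {a // g a = b}) := fun b =>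
    ⟨Fintype.equivOfCardEq (by rw [Fintype.card_subtype, Fintype.card_subtype, h b])⟩
  exact ⟨Equiv.ofFiberEquiv fun b => (e b).some, funext fun a => Equiv.ofFiberEquiv_map _ a⟩

theorem Equiv.Perm.card_filter_comp {α : Type*} [Fintype α] (k : Equiv.Perm α) (p : α → Prop)
    [DecidablePred p] :
    (Finset.univ.filter fun a => p (k a)).card = (Finset.univ.filter p).card := by
  rw [← Fintype.card_subtype, ← Fintype.card_subtype]
  exact Fintype.card_congr (k.subtypeEquiv fun a => Iff.rfl)

/-- If rearranging `y` by a permutation fixing `x ⊓ y` does not change `x ⊓ y`, then `y` and its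
rearrangement differ by a permutation fixing `x`. -/
theorem Equiv.Perm.exists_comp_eq_of_inf_eq {α : Type*} [Fintype α] (x y : α → ℕ)
    (k : Equiv.Perm α) (hk : (x ⊓ y) ∘ k = x ⊓ y) (hxy : x ⊓ (y ∘ k) = x ⊓ y) :
    ∃ h : Equiv.Perm α, x ∘ h = x ∧ (y ∘ k) ∘ h = y := by
  classical
  have hk' : ∀ p, min (x (k p)) (y (k p)) = min (x p) (y p) := fun p => congrFun hk p
  have hxy' : ∀ p, min (x p) (y (k p)) = min (x p) (y p) := fun p => congrFun hxy p
  obtain ⟨h, hh⟩ := exists_comp_eq_of_card_fiber_eq (fun p => (x p, y p))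
    (fun p => (x p, y (k p))) (by
      rintro ⟨a, b⟩
      simp only [Prod.mk.injEq]
      -- `k` preserves the level sets of `x ⊓ y`, so `y` and `y ∘ k` have the same distribution on
      -- each.
      have key : ∀ c, (Finset.univ.filter fun p => min (x p) (y p) = a ∧ y (k p) = c).card =
          (Finset.univ.filter fun p => min (x p) (y p) = a ∧ y p = c).card := by
        intro c
        rw [← card_filter_comp k fun p => min (x p) (y p) = a ∧ y p = c]
        simp only [hk']
      rcases lt_trichotomy a b with hab | rfl | hab
      · calc (Finset.univ.filter fun p => x p = a ∧ y p = b).card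
            = (Finset.univ.filter fun p => min (x p) (y p) = a ∧ y p = b).card := by
              congr 1; ext p; simp only [Finset.mem_filter]; grind
          _ = (Finset.univ.filter fun p => min (x p) (y p) = a ∧ y (k p) = b).card :=
              (key b).symm
          _ = _ := by
              congr 1; ext p; have := hxy' p; simp only [Finset.mem_filter]; grind
      -- On the level set `a`, positions with `x ≠ a` have both `y` and `y ∘ k` equal to `a`; this
      -- common part cancels.
      · have h1 : (Finset.univ.filter fun p => min (x p) (y p) = a ∧ y p = a).card =
            (Finset.univ.filter fun p => x p = a ∧ y p = a).card +
            (Finset.univ.filter fun p => min (x p) (y p) = a ∧ x p ≠ a).card := by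
          rw [← Finset.card_union_of_disjoint (by
            rw [Finset.disjoint_left]; intro p; simp only [Finset.mem_filter]; tauto)]
          congr 1; ext p; simp only [Finset.mem_filter, Finset.mem_union]; grind
        have h2 : (Finset.univ.filter fun p => min (x p) (y p) = a ∧ y (k p) = a).card =
            (Finset.univ.filter fun p => x p = a ∧ y (k p) = a).card +
            (Finset.univ.filter fun p => min (x p) (y p) = a ∧ x p ≠ a).card := by
          rw [← Finset.card_union_of_disjoint (by
            rw [Finset.disjoint_left]; intro p; simp only [Finset.mem_filter]; tauto)]
          congr 1; ext p; have := hxy' p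
          simp only [Finset.mem_filter, Finset.mem_union]; grind
        have h3 := key a
        omega
      · congr 1; ext p; have := hxy' p; simp only [Finset.mem_filter]; grind)
  refine ⟨h, funext fun p => ?_, funext fun p => ?_⟩
  · exact congrArg Prod.fst (congrFun hh p)
  · exact congrArg Prod.snd (congrFun hh p)

/-- The permutations of the positions that fix a word. -/
def wordStabilizer {α β : Type*} (x : α → β) : Subgroup (Equiv.Perm α) where
  carrier := {σ | x ∘ σ = x}
  one_mem' := rfl
  mul_mem' {σ τ} hσ hτ := by
    change (x ∘ σ) ∘ τ = x
    rw [show x ∘ σ = x from hσ]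
    exact hτ
  inv_mem' {σ} hσ := by
    change x ∘ σ.symm = x
    conv_lhs => rw [← show x ∘ σ = x from hσ]
    ext p
    simp

theorem mem_wordStabilizer {α β : Type*} {x : α → β} {σ : Equiv.Perm α} :
    σ ∈ wordStabilizer x ↔ x ∘ σ = x := Iff.rfl

theorem wordStabilizer_eq_bot_of_injective {α β : Type*} {x : α → β}
    (hx : Function.Injective x) : wordStabilizer x = ⊥ :=
  (Subgroup.eq_bot_iff_forall _).2 fun _ hσ => Equiv.ext fun p => hx (congrFun hσ p)

-- The product set is the orbit of `1` under `P × Q` acting by left and inverse right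
-- multiplication. Hence its size is invertible in `K` when the group orders are.
open scoped Pointwise in
theorem Subgroup.card_mul_dvd {G : Type*} [Group G] (P Q : Subgroup G) :
    Nat.card ((P : Set G) * (Q : Set G) : Set G) ∣ Nat.card P * Nat.card Q := by
  let _ : MulAction (P × Q) G :=
    { smul := fun x k => x.1 * k * (x.2 : G)⁻¹
      one_smul := fun k => by
        change ((1 : P) : G) * k * ((1 : Q) : G)⁻¹ = k
        simp
      mul_smul := fun x y k => by
        change ((x.1 * y.1 : P) : G) * k * ((x.2 * y.2 : Q) : G)⁻¹ =
          x.1 * (y.1 * k * (y.2 : G)⁻¹) * (x.2 : G)⁻¹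
        simp [mul_assoc] }
  have h : MulAction.orbit (P × Q) (1 : G) = (P : Set G) * (Q : Set G) := by
    ext k
    rw [MulAction.mem_orbit_iff, Set.mem_mul]
    constructor
    · rintro ⟨x, rfl⟩
      exact ⟨x.1, x.1.2, (x.2 : G)⁻¹, Q.inv_mem x.2.2, by
        change _ = x.1 * 1 * (x.2 : G)⁻¹
        simp⟩
    · rintro ⟨a, ha, b, hb, rfl⟩
      refine ⟨(⟨a, ha⟩, ⟨b, hb⟩⁻¹), ?_⟩
      change a * 1 * ((⟨b, hb⟩⁻¹ : Q) : G)⁻¹ = a * b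
      simp
  rw [← Nat.card_prod, ← h, Nat.card_congr (MulAction.orbitEquivQuotientStabilizer (P × Q) (1 : G))]
  exact Subgroup.card_quotient_dvd_card _

/-! ### Invariants of symmetric groups -/

open scoped Classical in
/-- The sum of a representation over a subgroup. -/
noncomputable def Representation.subgroupSum {K G M : Type*} [Field K] [Group G] [Fintype G]
    [AddCommGroup M] [Module K M] (ρ : Representation K G M) (H : Subgroup G) : M →ₗ[K] M :=
  ∑ k ∈ Finset.univ.filter (· ∈ H), ρ k

namespace Representation

section SubgroupSum

variable {K G M : Type*} [Field K] [Group G] [Fintype G] [AddCommGroup M] [Module K M]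
  (ρ : Representation K G M) (H : Subgroup G)

open scoped Classical in
theorem subgroupSum_apply (x : M) :
    ρ.subgroupSum H x = ∑ k ∈ Finset.univ.filter (· ∈ H), ρ k x := by
  simp [subgroupSum]

theorem map_subgroupSum {h : G} (hh : h ∈ H) (x : M) :
    ρ h (ρ.subgroupSum H x) = ρ.subgroupSum H x := by
  classical
  simp only [subgroupSum_apply, map_sum]
  refine Finset.sum_equiv (Equiv.mulLeft h) (fun k => ?_) (fun k _ => ?_)
  · simp [H.mul_mem_cancel_left hh]
  · simp

theorem subgroupSum_map {h : G} (hh : h ∈ H) (x : M) :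
    ρ.subgroupSum H (ρ h x) = ρ.subgroupSum H x := by
  classical
  simp only [subgroupSum_apply]
  refine Finset.sum_equiv (Equiv.mulRight h) (fun k => ?_) (fun k _ => ?_)
  · simp [H.mul_mem_cancel_right hh]
  · simp

theorem subgroupSum_of_invariant {x : M} (hx : ∀ h ∈ H, ρ h x = x) :
    ρ.subgroupSum H x = (Nat.card H : K) • x := by
  classical
  rw [subgroupSum_apply, Finset.sum_congr rfl (fun k hk => hx k (Finset.mem_filter.1 hk).2),
    Finset.sum_const, Nat.card_eq_fintype_card, Fintype.card_subtype, Nat.cast_smul_eq_nsmul]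

end SubgroupSum

variable {K α M : Type*} [Field K] [Fintype α] [DecidableEq α] [AddCommGroup M] [Module K M]
  (ρ : Representation K (Equiv.Perm α) M)

theorem _root_.Equiv.Perm.natCast_card_subgroup_ne_zero
    (hK : ((Fintype.card α).factorial : K) ≠ 0) (H : Subgroup (Equiv.Perm α)) :
    (Nat.card H : K) ≠ 0 := by
  intro h
  apply hK
  obtain ⟨c, hc⟩ := H.card_subgroup_dvd_card
  rw [Nat.card_eq_fintype_card (α := Equiv.Perm α), Fintype.card_perm] at hc
  rw [hc, Nat.cast_mul, h, zero_mul]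

open scoped Pointwise in
/-- If no word with a smaller sum of letters than `x` has a stabilizer with nonzero invariants,
then the invariants of the stabilizer of `x` in the submodule generated by an invariant `v` are the
multiples of `v`. -/
theorem subgroupSum_mem_span_of_minimal (hK : ((Fintype.card α).factorial : K) ≠ 0) (x : α → ℕ)
    (hmin : ∀ u : α → ℕ, ∑ p, u p < ∑ p, x p →
      ∀ y : M, (∀ k ∈ wordStabilizer u, ρ k y = y) → y = 0)
    {v : M} (hv : ∀ h ∈ wordStabilizer x, ρ h v = v) (g : Equiv.Perm α) :
    ρ.subgroupSum (wordStabilizer x) (ρ g v) ∈ Submodule.span K {v} := by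
  classical
  -- Induction on how far `x` and its translate by `g` are from overlapping; the defect vanishes
  -- only if they agree.
  induction hN : ∑ p, x p - ∑ p, (x ⊓ (x ∘ g.symm)) p using Nat.strong_induction_on
    generalizing g with
  | _ N ih =>
  set y : α → ℕ := x ∘ g.symm with hy
  have hyx : y ∘ g = x := by ext p; simp [hy]
  have hle : ∀ z : α → ℕ, ∑ p, (x ⊓ z) p ≤ ∑ p, x p := fun z =>
    Finset.sum_le_sum fun p _ => min_le_left _ _
  by_cases hxy : y = x
  · have hg : g ∈ wordStabilizer x := by
      rw [mem_wordStabilizer]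
      conv_lhs => rw [← hxy]
      exact hyx
    rw [hv g hg, ρ.subgroupSum_of_invariant _ hv]
    exact Submodule.smul_mem _ _ (Submodule.mem_span_singleton_self v)
  have hsum : ∑ p, y p = ∑ p, x p := Equiv.sum_comp g.symm x
  have hlt : ∑ p, (x ⊓ y) p < ∑ p, x p := by
    refine lt_of_le_of_ne (hle y) fun h => hxy ?_
    have h1 : ∀ p, (x ⊓ y) p = x p := fun p =>
      (Finset.sum_eq_sum_iff_of_le fun p _ => (min_le_left _ _ : (x ⊓ y) p ≤ x p)).1 h p
        (Finset.mem_univ p)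
    have h2 : ∀ p, (x ⊓ y) p = y p := fun p =>
      (Finset.sum_eq_sum_iff_of_le fun p _ => (min_le_right _ _ : (x ⊓ y) p ≤ y p)).1
        (h.trans hsum.symm) p (Finset.mem_univ p)
    exact funext fun p => (h2 p).symm.trans (h1 p)
  set U := wordStabilizer (x ⊓ y) with hU
  set P := U ⊓ wordStabilizer x with hP
  set Q := U ⊓ wordStabilizer y with hQ
  -- `U` stabilizes a word of smaller letter sum, so it has no nonzero invariants.
  have hzero : ρ.subgroupSum U (ρ g v) = 0 :=
    hmin _ hlt _ fun k hk => ρ.map_subgroupSum U hk _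
  -- The factor from `P` is absorbed by the outer sum; the factor from `Q` fixes `ρ g v`, whose
  -- invariance group contains the stabilizer of `y`.
  have hPQ : ∀ k ∈ (P : Set (Equiv.Perm α)) * (Q : Set (Equiv.Perm α)),
      ρ.subgroupSum (wordStabilizer x) (ρ k (ρ g v)) =
        ρ.subgroupSum (wordStabilizer x) (ρ g v) := by
    rintro _ ⟨a, ha, b, hb, rfl⟩
    have hb' : g⁻¹ * b * g ∈ wordStabilizer x := by
      rw [mem_wordStabilizer]
      have h1 : y ∘ b = y := hb.2
      calc x ∘ (g⁻¹ * b * g : Equiv.Perm α) = (y ∘ b) ∘ g := rfl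
        _ = x := by rw [h1, hyx]
    have h2 : ρ (a * b) (ρ g v) = ρ a (ρ g (ρ (g⁻¹ * b * g) v)) := by
      simp only [← Module.End.mul_apply, ← map_mul]
      congr 2
      group
    change ρ.subgroupSum _ (ρ (a * b) (ρ g v)) = _
    rw [h2, hv _ hb', ρ.subgroupSum_map _ ha.2]
  -- Elements of `U` never decrease the overlap, and those that keep it lie in `PQ`; the rest are
  -- covered by induction.
  have hbad : ∀ k ∈ U, k ∉ (P : Set (Equiv.Perm α)) * (Q : Set (Equiv.Perm α)) →
      ρ.subgroupSum (wordStabilizer x) (ρ k (ρ g v)) ∈ Submodule.span K {v} := by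
    intro k hk hkPQ
    have hsymm : (y ∘ k.symm) = x ∘ (k * g).symm := rfl
    rw [show ρ k (ρ g v) = ρ (k * g) v by rw [map_mul, Module.End.mul_apply]]
    refine ih _ ?_ (k * g) rfl
    rw [← hN, ← hsymm]
    have hk' : (x ⊓ y) ∘ k.symm = x ⊓ y := U.inv_mem hk
    have hle' : ∀ p, (x ⊓ y) p ≤ (x ⊓ (y ∘ k.symm)) p := fun p =>
      le_inf inf_le_left ((congrFun hk' p).symm.le.trans inf_le_right)
    have hlt' : ∑ p, (x ⊓ y) p < ∑ p, (x ⊓ (y ∘ k.symm)) p := by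
      refine lt_of_le_of_ne (Finset.sum_le_sum fun p _ => hle' p) fun h => hkPQ ?_
      have heq : x ⊓ (y ∘ k.symm) = x ⊓ y := funext fun p =>
        ((Finset.sum_eq_sum_iff_of_le fun p _ => hle' p).1 h p (Finset.mem_univ p)).symm
      obtain ⟨h, hx, hyh⟩ := Equiv.Perm.exists_comp_eq_of_inf_eq x y k.symm hk' heq
      have hhU : h ∈ U := by
        rw [hU, mem_wordStabilizer]
        conv_lhs => rw [← heq]
        calc (x ⊓ (y ∘ k.symm)) ∘ h = (x ∘ h) ⊓ ((y ∘ k.symm) ∘ h) := rfl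
          _ = x ⊓ y := by rw [hx, hyh]
      refine ⟨h, ⟨hhU, hx⟩, h⁻¹ * k, ⟨U.mul_mem (U.inv_mem hhU) hk, ?_⟩, by simp⟩
      change h⁻¹ * k ∈ wordStabilizer y
      rw [← inv_mem_iff]
      change y ∘ ((h⁻¹ * k)⁻¹ : Equiv.Perm α) = y
      rw [mul_inv_rev, inv_inv]
      exact hyh
    have := hle (y ∘ k.symm)
    omega
  have hcard : (Nat.card ((P : Set (Equiv.Perm α)) * (Q : Set (Equiv.Perm α)) :
      Set (Equiv.Perm α)) : K) ≠ 0 := by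
    intro h
    obtain ⟨c, hc⟩ := Subgroup.card_mul_dvd P Q
    have h1 := mul_ne_zero (Equiv.Perm.natCast_card_subgroup_ne_zero hK P)
      (Equiv.Perm.natCast_card_subgroup_ne_zero hK Q)
    rw [← Nat.cast_mul, hc, Nat.cast_mul, h, zero_mul] at h1
    exact h1 rfl
  have hPQU : ∀ k ∈ (P : Set (Equiv.Perm α)) * (Q : Set (Equiv.Perm α)), k ∈ U := by
    rintro _ ⟨a, ha, b, hb, rfl⟩
    exact U.mul_mem ha.1 hb.1
  have hsplit : (Nat.card ((P : Set (Equiv.Perm α)) * (Q : Set (Equiv.Perm α)) :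
      Set (Equiv.Perm α)) : K) • ρ.subgroupSum (wordStabilizer x) (ρ g v) +
      ∑ k ∈ Finset.univ.filter fun k => k ∈ U ∧ k ∉
        (P : Set (Equiv.Perm α)) * (Q : Set (Equiv.Perm α)),
        ρ.subgroupSum (wordStabilizer x) (ρ k (ρ g v)) = 0 := by
    have h := congrArg (ρ.subgroupSum (wordStabilizer x)) hzero
    rw [subgroupSum_apply ρ U, map_sum, map_zero, ← Finset.sum_filter_add_sum_filter_not _
      (· ∈ (P : Set (Equiv.Perm α)) * (Q : Set (Equiv.Perm α))), Finset.filter_filter,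
      Finset.filter_filter,
      Finset.sum_congr rfl (fun k hk => hPQ k (Finset.mem_filter.1 hk).2.2),
      Finset.sum_const] at h
    rw [← h, Nat.cast_smul_eq_nsmul, Nat.card_eq_fintype_card, Fintype.card_subtype]
    congr 3
    ext k
    simp only [Finset.mem_filter, Finset.mem_univ, true_and]
    exact ⟨fun hk => ⟨hPQU k hk, hk⟩, fun hk => hk.2⟩
  refine (Submodule.smul_mem_iff _ hcard).1 ?_
  rw [eq_neg_of_add_eq_zero_left hsplit]
  refine Submodule.neg_mem _ (Submodule.sum_mem _ fun k hk => ?_)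
  exact hbad k (Finset.mem_filter.1 hk).2.1 (Finset.mem_filter.1 hk).2.2

/-- If the characteristic does not divide the order of a symmetric group, then every irreducible
representation has a one-dimensional space of invariants under some subgroup. -/
theorem exists_subgroup_invariants_eq_span [Nontrivial M]
    (hK : ((Fintype.card α).factorial : K) ≠ 0)
    (hρ : ∀ v : M, v ≠ 0 → Submodule.span K (Set.range fun g => ρ g v) = ⊤) :
    ∃ (H : Subgroup (Equiv.Perm α)) (v : M), v ≠ 0 ∧ (∀ h ∈ H, ρ h v = v) ∧
      ∀ y : M, (∀ h ∈ H, ρ h y = y) → y ∈ Submodule.span K {v} := by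
  classical
  have hex : ∃ N : ℕ, ∃ x : α → ℕ, ∑ p, x p = N ∧
      ∃ v : M, v ≠ 0 ∧ ∀ h ∈ wordStabilizer x, ρ h v = v := by
    obtain ⟨v, hv⟩ := exists_ne (0 : M)
    -- An injective word has trivial stabilizer, so every vector is invariant.
    refine ⟨_, Fin.val ∘ Fintype.equivFin α, rfl, v, hv, fun h hh => ?_⟩
    rw [wordStabilizer_eq_bot_of_injective
      (Fin.val_injective.comp (Fintype.equivFin α).injective), Subgroup.mem_bot] at hh
    simp [hh]
  obtain ⟨x, hx, v, hv0, hv⟩ := Nat.find_spec hex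
  refine ⟨wordStabilizer x, v, hv0, hv, fun y hy => ?_⟩
  have hmin : ∀ u : α → ℕ, ∑ p, u p < ∑ p, x p →
      ∀ y : M, (∀ k ∈ wordStabilizer u, ρ k y = y) → y = 0 := by
    intro u hu y hy
    by_contra hy0
    exact Nat.find_min hex (hx ▸ hu) ⟨u, rfl, y, hy0, hy⟩
  refine (Submodule.smul_mem_iff _
    (Equiv.Perm.natCast_card_subgroup_ne_zero hK (wordStabilizer x))).1 ?_
  rw [← ρ.subgroupSum_of_invariant _ hy]
  have hle : (⊤ : Submodule K M) ≤
      (Submodule.span K {v}).comap (ρ.subgroupSum (wordStabilizer x)) := by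
    rw [← hρ v hv0, Submodule.span_le]
    rintro _ ⟨g, rfl⟩
    exact ρ.subgroupSum_mem_span_of_minimal hK x hmin hv g
  exact hle (Submodule.mem_top (x := y))

end Representation

/-! ### Scalar endomorphisms of simple modules -/

theorem natCast_factorial_ne_zero_of_ringChar {K : Type*} [Field K] {n : ℕ}
    (hK : ringChar K = 0 ∨ n < ringChar K) : (n.factorial : K) ≠ 0 := by
  intro h
  rw [ringChar.spec] at h
  rcases hK with hK | hK
  · rw [hK, zero_dvd_iff] at h
    exact n.factorial_ne_zero h
  · have hp : (ringChar K).Prime :=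
      (CharP.char_is_prime_or_zero K (ringChar K)).resolve_right (by omega)
    exact absurd ((hp.dvd_factorial).1 h) (by omega)

/-- If the characteristic does not divide `n!`, then the endomorphisms of a simple `K Sₙ`-module are
the scalars. -/
theorem exists_smul_eq_of_isSimpleModule_perm {K α S : Type*} [Field K] [Fintype α]
    [DecidableEq α] (hK : ((Fintype.card α).factorial : K) ≠ 0)
    [AddCommGroup S] [Module K S] [Module K[Equiv.Perm α] S]
    [IsScalarTower K K[Equiv.Perm α] S] [IsSimpleModule K[Equiv.Perm α] S]
    (f : S →ₗ[K[Equiv.Perm α]] S) : ∃ c : K, ∀ x, f x = c • x := by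
  have := IsSimpleModule.nontrivial K[Equiv.Perm α] S
  set ρ : Representation K (Equiv.Perm α) S := Representation.ofModule' S
  have hρ_apply : ∀ g y, ρ g y = MonoidAlgebra.single g (1 : K) • y := fun g y => by
    simp [ρ, Representation.ofModule']
  have hρ : ∀ v : S, v ≠ 0 → Submodule.span K (Set.range fun g => ρ g v) = ⊤ := by
    intro v hv
    rw [eq_top_iff]
    rintro y -
    obtain ⟨a, rfl⟩ := IsSimpleModule.toSpanSingleton_surjective K[Equiv.Perm α] hv y
    rw [LinearMap.toSpanSingleton_apply]
    induction a using MonoidAlgebra.induction_linear with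
    | zero => simp
    | add a b ha hb => rw [add_smul]; exact Submodule.add_mem _ ha hb
    | single g c =>
      have h : MonoidAlgebra.single g c • v = c • ρ g v := by
        rw [hρ_apply, ← smul_assoc, MonoidAlgebra.smul_single, smul_eq_mul, mul_one]
      rw [h]
      exact Submodule.smul_mem _ _ (Submodule.subset_span ⟨g, rfl⟩)
  obtain ⟨H, v, hv0, hv, hinv⟩ := ρ.exists_subgroup_invariants_eq_span hK hρ
  obtain ⟨c, hc⟩ := Submodule.mem_span_singleton.1 (hinv (f v) fun h hh => by
    rw [hρ_apply, ← map_smul, ← hρ_apply, hv h hh])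
  refine ⟨c, fun y => ?_⟩
  obtain ⟨a, rfl⟩ := IsSimpleModule.toSpanSingleton_surjective K[Equiv.Perm α] hv0 y
  rw [LinearMap.toSpanSingleton_apply, map_smul, ← hc]
  exact (smul_comm c a v).symm

/-! ### Generating sets of modules with a given decomposition -/

theorem IsRGeneratedModule.of_linearEquiv {A M N : Type*} [Ring A] [AddCommGroup M] [Module A M]
    [AddCommGroup N] [Module A N] {r : ℕ} (e : M ≃ₗ[A] N) (h : IsRGeneratedModule A r M) :
    IsRGeneratedModule A r N := by
  obtain ⟨f, hf⟩ := h
  refine ⟨e ∘ f, ?_⟩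
  have h1 : Submodule.span A (e '' Set.range f) = (Submodule.span A (Set.range f)).map e.toLinearMap :=
    Submodule.span_image e.toLinearMap
  rw [Set.range_comp, h1, hf, Submodule.map_top]
  exact LinearEquiv.range e

theorem isRGeneratedModule_congr {A M N : Type*} [Ring A] [AddCommGroup M] [Module A M]
    [AddCommGroup N] [Module A N] {r : ℕ} (e : M ≃ₗ[A] N) :
    IsRGeneratedModule A r M ↔ IsRGeneratedModule A r N :=
  ⟨fun h => h.of_linearEquiv e, fun h => h.of_linearEquiv e.symm⟩

section Decomposition

variable {K : Type*} {A : Type u} [Field K] [Ring A] [Algebra K A] {t : ℕ} {S : Fin t → Type v}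
  [∀ i, AddCommGroup (S i)] [∀ i, Module K (S i)] [∀ i, Module A (S i)]
  [∀ i, IsScalarTower K A (S i)]

/-- The linear combination of the components in the `i`-th isotypic part with coefficients `c`. -/
def isotypicCombination {m : Fin t → ℕ} (i : Fin t) (c : Fin (m i) → K) :
    ((i : Fin t) → Fin (m i) → S i) →ₗ[A] S i :=
  ∑ k, c k • ((LinearMap.proj (R := A) (φ := fun _ : Fin (m i) => S i) k).comp
    (LinearMap.proj (R := A) (φ := fun i => Fin (m i) → S i) i))

theorem isotypicCombination_apply {m : Fin t → ℕ} (i : Fin t) (c : Fin (m i) → K)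
    (y : (i : Fin t) → Fin (m i) → S i) :
    isotypicCombination (A := A) i c y = ∑ k, c k • y i k := by
  simp [isotypicCombination]

theorem multiplicity_le_of_isRGeneratedModule {m : Fin t → ℕ} {r : ℕ} (i : Fin t)
    [Nontrivial (S i)] [Module.Finite K (S i)]
    (h : IsRGeneratedModule A r ((i : Fin t) → Fin (m i) → S i)) :
    m i ≤ r * Module.finrank K (S i) := by
  obtain ⟨f, hf⟩ := h
  have hli : LinearIndependent K fun (k : Fin (m i)) (j : Fin r) => f j i k := by
    rw [Fintype.linearIndependent_iff]
    intro c hc k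
    have h0 : isotypicCombination (A := A) (S := S) i c = 0 := by
      refine LinearMap.ext_on_range hf fun j => ?_
      rw [isotypicCombination_apply, LinearMap.zero_apply]
      simpa using congrFun hc j
    obtain ⟨x, hx⟩ := exists_ne (0 : S i)
    have h1 := LinearMap.congr_fun h0 (Pi.single i (Pi.single k x))
    rw [isotypicCombination_apply, Pi.single_eq_same, Finset.sum_eq_single k
      (fun k' _ hk' => by rw [Pi.single_eq_of_ne hk', smul_zero]) (by simp), Pi.single_eq_same,
      LinearMap.zero_apply] at h1
    exact (smul_eq_zero.1 h1).resolve_right hx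
  have := hli.fintype_card_le_finrank
  rwa [Fintype.card_fin, Module.finrank_pi_fintype, Finset.sum_const, Finset.card_fin,
    smul_eq_mul] at this

/-- A quotient of `A` by a maximal left ideal brings `M` into the universe of `A`. -/
theorem IsCompleteSetOfSimples.exists_linearEquiv (hS : IsCompleteSetOfSimples A S)
    (M : Type*) [AddCommGroup M] [Module A M] [IsSimpleModule A M] :
    ∃ i, Nonempty (M ≃ₗ[A] S i) := by
  obtain ⟨I, hI, ⟨e⟩⟩ := isSimpleModule_iff_quot_maximal.1 (inferInstance : IsSimpleModule A M)
  have : IsSimpleModule A (A ⧸ I) := IsSimpleModule.congr e.symm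
  obtain ⟨i, ⟨e'⟩⟩ := hS.complete (A ⧸ I) this
  exact ⟨i, ⟨e.trans e'⟩⟩

/-- Over an algebra whose simple modules have only scalar endomorphisms, every homomorphism from
`⨁ᵢ mᵢ Sᵢ` to `Sᵢ` is a linear combination of components. -/
theorem IsCompleteSetOfSimples.exists_eq_isotypicCombination (hS : IsCompleteSetOfSimples A S)
    (hend : ∀ i (f : S i →ₗ[A] S i), ∃ c : K, ∀ x, f x = c • x) {m : Fin t → ℕ} {i : Fin t}
    (ψ : ((i : Fin t) → Fin (m i) → S i) →ₗ[A] S i) :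
    ∃ c : Fin (m i) → K, ψ = isotypicCombination i c := by
  have := hS.simple
  choose c hc using fun k : Fin (m i) => hend i
    ((ψ.comp (LinearMap.single A (fun i => Fin (m i) → S i) i)).comp
      (LinearMap.single A (fun _ => S i) k))
  refine ⟨c, LinearMap.pi_ext' fun i' => LinearMap.pi_ext' fun k => ?_⟩
  by_cases h : i' = i
  · subst h
    ext x
    rw [hc]
    simp only [LinearMap.comp_apply, LinearMap.single_apply, isotypicCombination_apply,
      Pi.single_eq_same]
    rw [Finset.sum_eq_single k (fun k' _ hk' => by rw [Pi.single_eq_of_ne hk', smul_zero])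
      (by simp), Pi.single_eq_same]
  · trans 0
    · refine (LinearMap.bijective_or_eq_zero _).resolve_left fun hb => h ?_
      exact hS.pairwise_not_iso _ _ ⟨LinearEquiv.ofBijective _ hb⟩
    · ext x
      simp only [LinearMap.comp_apply, LinearMap.single_apply, isotypicCombination_apply,
        LinearMap.zero_apply]
      exact (Finset.sum_eq_zero fun k _ => by
        rw [Pi.single_eq_of_ne (Ne.symm h), Pi.zero_apply, smul_zero]).symm

theorem IsCompleteSetOfSimples.isRGeneratedModule_of_multiplicity_le
    (hS : IsCompleteSetOfSimples A S) [∀ i, Module.Finite K (S i)]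
    (hend : ∀ i (f : S i →ₗ[A] S i), ∃ c : K, ∀ x, f x = c • x) {m : Fin t → ℕ} {r : ℕ}
    (h : ∀ i, m i ≤ r * Module.finrank K (S i)) :
    IsRGeneratedModule A r ((i : Fin t) → Fin (m i) → S i) := by
  have := hS.simple
  -- Each copy of `Sᵢ` receives its own pair (generator, basis vector); the bound on `m i` leaves
  -- room for this.
  let q : ∀ i, Fin (m i) → Fin r × Fin (Module.finrank K (S i)) := fun i k =>
    finProdFinEquiv.symm (Fin.castLE (h i) k)
  have hq : ∀ i, Function.Injective (q i) := fun i =>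
    finProdFinEquiv.symm.injective.comp (Fin.castLE_injective (h i))
  let b := fun i => Module.finBasis K (S i)
  refine ⟨fun j i k => if (q i k).1 = j then b i (q i k).2 else 0, ?_⟩
  by_contra hne
  obtain ⟨N, hN, hle⟩ := (eq_top_or_exists_le_coatom _).resolve_left hne
  have : IsSimpleModule A (((i : Fin t) → Fin (m i) → S i) ⧸ N) := isSimpleModule_iff_isCoatom.2 hN
  obtain ⟨i, ⟨e⟩⟩ := hS.exists_linearEquiv (((i : Fin t) → Fin (m i) → S i) ⧸ N)
  obtain ⟨c, hc⟩ := hS.exists_eq_isotypicCombination hend (e.toLinearMap.comp N.mkQ)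
  have hc0 : c = 0 := by
    funext k
    -- Evaluate on the generator assigned to copy `k`; the coordinate at its basis vector isolates
    -- `c k`, as `q i` is injective.
    have h1 : isotypicCombination (A := A) (S := S) i c
        (fun i' k' => if (q i' k').1 = (q i k).1 then b i' (q i' k').2 else 0) = 0 := by
      rw [← hc, LinearMap.comp_apply, Submodule.mkQ_apply,
        (Submodule.Quotient.mk_eq_zero N).2 (hle (Submodule.subset_span ⟨(q i k).1, rfl⟩)), map_zero]
    rw [isotypicCombination_apply] at h1
    have h2 := congrArg (fun x => (b i).repr x (q i k).2) h1
    simp only [map_sum, map_smul, map_zero, Finsupp.coe_finsetSum, Finset.sum_apply,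
      Finsupp.smul_apply, Finsupp.zero_apply, smul_eq_mul] at h2
    rw [Finset.sum_eq_single k] at h2
    · simpa using h2
    · intro k' _ hk'
      split_ifs with h3
      · have h4 : (q i k').2 ≠ (q i k).2 := fun h4 => hk' (hq i (Prod.ext h3 h4))
        rw [Module.Basis.repr_self, Finsupp.single_eq_of_ne h4.symm, mul_zero]
      · simp
    · simp
  obtain ⟨x, hx⟩ := @exists_ne (S i) (IsSimpleModule.nontrivial A (S i)) 0
  obtain ⟨y, hy⟩ := (e.surjective.comp N.mkQ_surjective) x
  refine hx ?_
  rw [← hy]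
  have := LinearMap.congr_fun hc y
  rw [hc0, isotypicCombination_apply] at this
  simpa using this

theorem IsCompleteSetOfSimples.isRGeneratedModule_iff
    (hS : IsCompleteSetOfSimples A S) [∀ i, Module.Finite K (S i)]
    (hend : ∀ i (f : S i →ₗ[A] S i), ∃ c : K, ∀ x, f x = c • x) {m : Fin t → ℕ}
    {V : Type*} [AddCommGroup V] [Module A V] (hV : HasDecomposition A S m V) (r : ℕ) :
    IsRGeneratedModule A r V ↔ ∀ i, m i ≤ r * Module.finrank K (S i) := by
  obtain ⟨e⟩ := hV
  rw [isRGeneratedModule_congr e]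
  refine ⟨fun h i => ?_, hS.isRGeneratedModule_of_multiplicity_le hend⟩
  have := hS.simple i
  have := IsSimpleModule.nontrivial A (S i)
  exact multiplicity_le_of_isRGeneratedModule i h

theorem IsCompleteSetOfSimples.nonempty_index (hS : IsCompleteSetOfSimples A S) [Nontrivial A] :
    Nonempty (Fin t) := by
  obtain ⟨I, hI⟩ := Ideal.exists_maximal A
  have : IsSimpleModule A (A ⧸ I) := isSimpleModule_iff_isCoatom.2 hI.out
  exact ⟨(hS.exists_linearEquiv (A ⧸ I)).choose⟩

end Decomposition

theorem Module.Finite.of_isSimpleModule (K A S : Type*) [Field K] [Ring A] [Algebra K A]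
    [Module.Finite K A] [AddCommGroup S] [Module K S] [Module A S] [IsScalarTower K A S]
    [IsSimpleModule A S] : Module.Finite K S :=
  Module.Finite.trans A S

theorem exists_isGreatest_isLeast_natCeil {ι : Type*} [Finite ι] [Nonempty ι] {P : ℕ → Prop}
    {m d : ι → ℕ} (hd : ∀ i, 0 < d i) (hP : ∀ r, P r ↔ ∀ i, m i ≤ r * d i) :
    ∃ q : ℚ, IsGreatest (Set.range fun i => (m i : ℚ) / (d i : ℚ)) q ∧ IsLeast {r | P r} ⌈q⌉₊ := by
  obtain ⟨i₀, hi₀⟩ := Finite.exists_max fun i => (m i : ℚ) / (d i : ℚ)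
  have hiff : ∀ r i, m i ≤ r * d i ↔ (m i : ℚ) / (d i : ℚ) ≤ r := fun r i => by
    rw [div_le_iff₀ (by exact_mod_cast hd i)]
    exact_mod_cast Iff.rfl
  refine ⟨_, ⟨⟨i₀, rfl⟩, ?_⟩, ?_, ?_⟩
  · rintro _ ⟨i, rfl⟩
    exact hi₀ i
  · exact (hP _).2 fun i => (hiff _ i).2 ((hi₀ i).trans (Nat.le_ceil _))
  · intro r hr
    exact Nat.ceil_le.2 ((hiff r i₀).1 ((hP r).1 hr i₀))

/-! ### Symmetric ideals generated in a single degree -/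

/-- Multiplication by a nonconstant monomial raises the degree, so only the constant term of `p`
reaches degree `e`. -/
theorem MvPolynomial.homogeneousComponent_mul_of_isHomogeneous {σ R : Type*} [CommSemiring R]
    {s : MvPolynomial σ R} {e k : ℕ} (hs : s.IsHomogeneous e) (hk : k ≤ e) (p : MvPolynomial σ R) :
    homogeneousComponent k (p * s) = if k = e then coeff 0 p • s else 0 := by
  classical
  induction p using MvPolynomial.induction_on' with
  | monomial a c =>
    have h : (monomial a c * s).IsHomogeneous (a.degree + e) :=
      (isHomogeneous_monomial c rfl).mul hs
    rw [homogeneousComponent_of_mem h, coeff_monomial]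
    by_cases ha : a = 0
    · subst ha
      simp [MvPolynomial.smul_eq_C_mul]
    · have h0 : a.degree ≠ 0 := fun h => ha ((Finsupp.degree_eq_zero_iff a).1 h)
      rw [if_neg (by omega), if_neg ha, zero_smul, ite_self]
  | add p q hp hq =>
    rw [add_mul, map_add, hp, hq, coeff_add, add_smul]
    split_ifs <;> simp

theorem MvPolynomial.homogeneousComponent_mem_span {σ R : Type*} [CommSemiring R]
    {X : Set (MvPolynomial σ R)} {e : ℕ} (hX : ∀ s ∈ X, s.IsHomogeneous e) {x : MvPolynomial σ R}
    (hx : x ∈ Ideal.span X) : homogeneousComponent e x ∈ Submodule.span R X := by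
  obtain ⟨c, hc, rfl⟩ := Submodule.mem_span_set.1 hx
  rw [Finsupp.sum, map_sum]
  refine Submodule.sum_mem _ fun s hs => ?_
  rw [smul_eq_mul, homogeneousComponent_mul_of_isHomogeneous (hX s (hc hs)) le_rfl, if_pos rfl]
  exact Submodule.smul_mem _ _ (Submodule.subset_span (hc hs))

theorem MvPolynomial.homogeneousComponent_eq_zero_of_mem_span {σ R : Type*} [CommSemiring R]
    {X : Set (MvPolynomial σ R)} {e k : ℕ} (hX : ∀ s ∈ X, s.IsHomogeneous e)
    {x : MvPolynomial σ R} (hx : x ∈ Ideal.span X) (hk : k < e) : homogeneousComponent k x = 0 := by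
  obtain ⟨c, hc, rfl⟩ := Submodule.mem_span_set.1 hx
  rw [Finsupp.sum, map_sum]
  refine Finset.sum_eq_zero fun s hs => ?_
  rw [smul_eq_mul, homogeneousComponent_mul_of_isHomogeneous (hX s (hc hs)) hk.le, if_neg hk.ne]

/-- The degree in which a nonzero ideal is generated by homogeneous polynomials is unique. -/
theorem MvPolynomial.le_of_span_le_span {σ R : Type*} [CommSemiring R]
    {X Y : Set (MvPolynomial σ R)} {d e : ℕ} (hX : ∀ s ∈ X, s.IsHomogeneous d)
    (hY : ∀ s ∈ Y, s.IsHomogeneous e) (h : Ideal.span X ≤ Ideal.span Y)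
    (h0 : Ideal.span X ≠ ⊥) : e ≤ d := by
  obtain ⟨x, hx, hx0⟩ : ∃ x ∈ X, x ≠ 0 := by
    by_contra! hcon
    exact h0 (Ideal.span_eq_bot.2 hcon)
  by_contra! hlt
  have := homogeneousComponent_eq_zero_of_mem_span hY (h (Ideal.subset_span hx)) hlt
  rw [homogeneousComponent_eq_self (hX x hx)] at this
  exact hx0 this

theorem Representation.symm_mem_span_range_iff {K G V ι : Type*} [Field K] [Group G]
    [AddCommGroup V] [Module K V] (ρ : Representation K G V) (f : ι → V) (y : V) :
    ρ.asModuleEquiv.symm y ∈ Submodule.span K[G] (Set.range fun j => ρ.asModuleEquiv.symm (f j)) ↔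
      y ∈ Submodule.span K {z | ∃ (σ : G) (j : ι), z = ρ σ (f j)} := by
  set N := Submodule.span K {z | ∃ (σ : G) (j : ι), z = ρ σ (f j)} with hN
  have hρ : ∀ g, ∀ z ∈ N, ρ g z ∈ N := by
    intro g
    change N ≤ N.comap (ρ g)
    rw [hN, Submodule.span_le]
    rintro _ ⟨σ, j, rfl⟩
    exact Submodule.subset_span ⟨g * σ, j, by rw [map_mul, Module.End.mul_apply]⟩
  constructor
  · intro hy
    suffices h : ∀ x : ρ.asModule,
        x ∈ Submodule.span K[G] (Set.range fun j => ρ.asModuleEquiv.symm (f j)) →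
          ρ.asModuleEquiv x ∈ N by
      simpa using h _ hy
    intro x hx
    induction hx using Submodule.span_induction with
    | mem x hx =>
      obtain ⟨j, rfl⟩ := hx
      exact Submodule.subset_span ⟨1, j, by simp⟩
    | zero => rw [map_zero]; exact N.zero_mem
    | add x y _ _ hx hy => rw [map_add]; exact N.add_mem hx hy
    | smul a x _ hx =>
      rw [asModuleEquiv_map_smul]
      induction a using MonoidAlgebra.induction_linear with
      | zero => simp
      | add a b ha hb => rw [map_add, LinearMap.add_apply]; exact N.add_mem ha hb
      | single g c =>
        rw [asAlgebraHom_single, LinearMap.smul_apply]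
        exact N.smul_mem _ (hρ g _ hx)
  · intro hy
    induction hy using Submodule.span_induction with
    | mem x hx =>
      obtain ⟨σ, j, rfl⟩ := hx
      rw [asModuleEquiv_symm_map_rho]
      exact Submodule.smul_mem _ _ (Submodule.subset_span ⟨j, rfl⟩)
    | zero => rw [map_zero]; exact Submodule.zero_mem _
    | add x y _ _ hx hy => rw [map_add]; exact Submodule.add_mem _ hx hy
    | smul c x _ hx =>
      rw [asModuleEquiv_symm_map_smul]
      exact Submodule.smul_mem _ _ hx

section SymmetricIdeal

variable {K : Type*} [Field K] {n : ℕ}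

theorem permRep_isHomogeneous {d : ℕ} (σ : Equiv.Perm (Fin n)) {f : MvPolynomial (Fin n) K}
    (hf : f.IsHomogeneous d) : (permRep K n σ f).IsHomogeneous d :=
  MvPolynomial.IsHomogeneous.rename_isHomogeneous hf

theorem span_range_eq_top_iff {I : Ideal (MvPolynomial (Fin n) K)} (hI : IsSymmetricIdeal I)
    {d r : ℕ} (f : Fin r → (idealDegreePart I hI d).toSubmodule) :
    Submodule.span K[Equiv.Perm (Fin n)] (Set.range fun j =>
        (idealDegreePart I hI d).toRepresentation.asModuleEquiv.symm (f j)) = ⊤ ↔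
      ∀ x ∈ I, x.IsHomogeneous d → x ∈ Submodule.span K
        {g | ∃ (σ : Equiv.Perm (Fin n)) (j : Fin r), g = permRep K n σ (f j)} := by
  have himage : Submodule.span K
      {g | ∃ (σ : Equiv.Perm (Fin n)) (j : Fin r), g = permRep K n σ (f j)} =
      (Submodule.span K {z | ∃ (σ : Equiv.Perm (Fin n)) (j : Fin r),
        z = (idealDegreePart I hI d).toRepresentation σ (f j)}).map
        (idealDegreePart I hI d).toSubmodule.subtype := by
    rw [Submodule.map_span]
    congr 1
    ext g
    constructor
    · rintro ⟨σ, j, rfl⟩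
      exact ⟨_, ⟨σ, j, rfl⟩, rfl⟩
    · rintro ⟨_, ⟨σ, j, rfl⟩, rfl⟩
      exact ⟨σ, j, rfl⟩
  rw [himage, Submodule.eq_top_iff']
  constructor
  · intro h x hx hxd
    exact ⟨⟨x, hx, hxd⟩, (Representation.symm_mem_span_range_iff _ _ _).1
      (h ((idealDegreePart I hI d).toRepresentation.asModuleEquiv.symm ⟨x, hx, hxd⟩)), rfl⟩
  · intro h y
    obtain ⟨y, rfl⟩ := (idealDegreePart I hI d).toRepresentation.asModuleEquiv.symm.surjective y
    obtain ⟨z, hz, hzy⟩ := h y y.2.1 y.2.2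
    rw [← Subtype.ext hzy]
    exact (Representation.symm_mem_span_range_iff _ _ _).2 hz

theorem isRGeneratedSymmetricIdeal_iff {d : ℕ} {I : Ideal (MvPolynomial (Fin n) K)}
    (hI : IsSymmetricIdeal I) (hd : IsGeneratedInDegree d I) (r : ℕ) :
    IsRGeneratedSymmetricIdeal r I ↔
      IsRGeneratedModule K[Equiv.Perm (Fin n)] r
        (idealDegreePart I hI d).toRepresentation.asModule := by
  constructor
  · rintro ⟨e, f, hf, hIf⟩
    -- The zero ideal does not determine the degree `e`, but then `I_d = 0` is generated by zeros.
    by_cases h0 : I = ⊥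
    · refine ⟨fun _ => 0, ?_⟩
      have := (span_range_eq_top_iff hI (fun _ : Fin r =>
        (0 : (idealDegreePart I hI d).toSubmodule))).2 fun x hx _ => by
          rw [h0, Ideal.mem_bot] at hx
          rw [hx]
          exact Submodule.zero_mem _
      simpa using this
    · have hfe : ∀ s ∈ {g | ∃ (σ : Equiv.Perm (Fin n)) (j : Fin r), g = permRep K n σ (f j)},
          s.IsHomogeneous e := by
        rintro _ ⟨σ, j, rfl⟩
        exact permRep_isHomogeneous σ (hf j)
      have hde : d = e := le_antisymm
        (MvPolynomial.le_of_span_le_span hfe (fun s hs => hs.2) (hIf.symm.trans hd).le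
          (fun h => h0 (hIf.trans h)))
        (MvPolynomial.le_of_span_le_span (fun s hs => hs.2) hfe (hd.symm.trans hIf).le
          (fun h => h0 (hd.trans h)))
      subst hde
      have hfI : ∀ j, f j ∈ I := fun j => by
        rw [hIf]
        exact Ideal.subset_span ⟨1, j, by simp⟩
      refine ⟨_, (span_range_eq_top_iff hI fun j => ⟨f j, hfI j, hf j⟩).2 fun x hx hxd => ?_⟩
      rw [hIf] at hx
      have := MvPolynomial.homogeneousComponent_mem_span hfe hx
      rwa [MvPolynomial.homogeneousComponent_eq_self hxd] at this
  · rintro ⟨F, hF⟩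
    set f : Fin r → (idealDegreePart I hI d).toSubmodule := fun j =>
      (idealDegreePart I hI d).toRepresentation.asModuleEquiv (F j) with hf
    have hspan := (span_range_eq_top_iff hI f).1 (by simpa [hf] using hF)
    refine ⟨d, fun j => f j, fun j => (f j).2.2, le_antisymm ?_ ?_⟩
    · refine hd.le.trans (Ideal.span_le.2 ?_)
      rintro x ⟨hx, hxd⟩
      exact Submodule.span_le_restrictScalars K (MvPolynomial (Fin n) K) _ (hspan x hx hxd)
    · refine Ideal.span_le.2 ?_
      rintro _ ⟨σ, j, rfl⟩
      exact hI σ _ (f j).2.1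

end SymmetricIdeal

theorem mainTheorem6 (K : Type u) [Field K] (n : ℕ)
    (hK : ringChar K = 0 ∨ n < ringChar K)
    (t : ℕ) (S : Fin t → Type v)
    [∀ i, AddCommGroup (S i)] [∀ i, Module K (S i)]
    [∀ i, Module (MonoidAlgebra K (Equiv.Perm (Fin n))) (S i)]
    [∀ i, IsScalarTower K (MonoidAlgebra K (Equiv.Perm (Fin n))) (S i)]
    (hS : IsCompleteSetOfSimples (MonoidAlgebra K (Equiv.Perm (Fin n))) S) :
    -- finitely generated modules
    (∀ (V : Type w) [AddCommGroup V] [Module (MonoidAlgebra K (Equiv.Perm (Fin n))) V]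
        [Module.Finite (MonoidAlgebra K (Equiv.Perm (Fin n))) V] (m : Fin t → ℕ),
      HasDecomposition (MonoidAlgebra K (Equiv.Perm (Fin n))) S m V →
      (∀ r : ℕ, IsRGeneratedModule (MonoidAlgebra K (Equiv.Perm (Fin n))) r V ↔
        ∀ i, m i ≤ r * Module.finrank K (S i)) ∧
      ∃ q : ℚ, IsGreatest (Set.range fun i => (m i : ℚ) / (Module.finrank K (S i) : ℚ)) q ∧
        IsLeast {r : ℕ | IsRGeneratedModule (MonoidAlgebra K (Equiv.Perm (Fin n))) r V} ⌈q⌉₊) ∧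
    -- symmetric ideals generated in a single degree
    (∀ (d : ℕ) (I : Ideal (MvPolynomial (Fin n) K)) (hI : IsSymmetricIdeal I),
      IsGeneratedInDegree d I → ∀ m : Fin t → ℕ,
      HasDecomposition (MonoidAlgebra K (Equiv.Perm (Fin n))) S m
        (idealDegreePart I hI d).toRepresentation.asModule →
      (∀ r : ℕ, IsRGeneratedSymmetricIdeal r I ↔ ∀ i, m i ≤ r * Module.finrank K (S i)) ∧
      (∃ q : ℚ, IsGreatest (Set.range fun i => (m i : ℚ) / (Module.finrank K (S i) : ℚ)) q ∧
        IsLeast {r : ℕ | IsRGeneratedSymmetricIdeal r I} ⌈q⌉₊) ∧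
      (IsPrincipalSymmetricIdeal I ↔ ∀ i, m i ≤ Module.finrank K (S i))) := by
  have hfac : ((Fintype.card (Fin n)).factorial : K) ≠ 0 := by
    rw [Fintype.card_fin]
    exact natCast_factorial_ne_zero_of_ringChar hK
  have hsimple := hS.simple
  have hfin : ∀ i, Module.Finite K (S i) := fun i =>
    Module.Finite.of_isSimpleModule K K[Equiv.Perm (Fin n)] (S i)
  have hend : ∀ i (f : S i →ₗ[K[Equiv.Perm (Fin n)]] S i), ∃ c : K, ∀ x, f x = c • x :=
    fun i f => exists_smul_eq_of_isSimpleModule_perm hfac f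
  have hpos : ∀ i, 0 < Module.finrank K (S i) := fun i => by
    have := IsSimpleModule.nontrivial K[Equiv.Perm (Fin n)] (S i)
    exact Module.finrank_pos
  have hne : Nonempty (Fin t) := hS.nonempty_index
  constructor
  · intro V _ _ _ m hV
    have h := hS.isRGeneratedModule_iff hend hV
    exact ⟨h, exists_isGreatest_isLeast_natCeil hpos h⟩
  · intro d I hI hd m hm
    have h : ∀ r, IsRGeneratedSymmetricIdeal r I ↔ ∀ i, m i ≤ r * Module.finrank K (S i) :=
      fun r => (isRGeneratedSymmetricIdeal_iff hI hd r).trans (hS.isRGeneratedModule_iff hend hm r)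
    exact ⟨h, exists_isGreatest_isLeast_natCeil hpos h, by simpa [IsPrincipalSymmetricIdeal] using h 1⟩
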